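/- Let $H_1,H_2$ be complex Hilbert spaces and let $T:D(T)\subseteq H_1\to H_2$ be a densely defined closed linear operator that is unbounded. Write $N(T)=\{x\in D(T):Tx=0\}$ and $R(T)=\{Tx:x\in D(T)\}$. Call $T$ absolutely minimum attaining if for every closed subspace $M$ of $H_1$ with $M\cap D(T)\neq\{0\}$ there is $x_0\in M\cap D(T)$ with $\|x_0\|=1$ and $\|Tx_0\|=\inf\{\|Tx\|:x\in M\cap D(T),\ \|x\|=1\}$. Let $T^\dagger$ be the Moore–Penrose inverse of $T$, i.e. the linear operator with domain $D(T^\dagger)=R(T)\oplus R(T)^\perp\subseteq H_2$ that sends $y$ to the unique $x\in D(T)\cap N(T)^\perp$ for which $Tx$ is the orthogonal projection of $y$ onto $\overline{R(T)}$. Then $T$ is absolutely minimum attaining if and only if $N(T)$ is finite-dimensional and $T^\dagger$ is a compact operator from $H_2$ to $H_1$ (in particular, defined on all of $H_2$). -/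

import Mathlib

namespace LinearPMap

variable {H₁ H₂ : Type*}
  [NormedAddCommGroup H₁] [InnerProductSpace ℂ H₁]
  [NormedAddCommGroup H₂] [InnerProductSpace ℂ H₂]

/-- The null space `N(T) = {x ∈ D(T) : T x = 0}`, as a subspace of `H₁`. -/
def nullSpace (T : H₁ →ₗ.[ℂ] H₂) : Submodule ℂ H₁ :=
  (LinearMap.ker T.toFun).map T.domain.subtype

/-- The range `R(T) = {T x : x ∈ D(T)}`, as a subspace of `H₂`. -/
def rangeSpace (T : H₁ →ₗ.[ℂ] H₂) : Submodule ℂ H₂ :=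
  LinearMap.range T.toFun

/-- `T` is bounded on its domain. -/
def IsBounded (T : H₁ →ₗ.[ℂ] H₂) : Prop :=
  ∃ C : ℝ, ∀ x : T.domain, ‖T x‖ ≤ C * ‖(x : H₁)‖

/-- The minimum modulus `m(T) = inf {‖T x‖ : x ∈ D(T), ‖x‖ = 1}`. -/
noncomputable def minModulus (T : H₁ →ₗ.[ℂ] H₂) : ℝ :=
  sInf {r : ℝ | ∃ x : T.domain, ‖(x : H₁)‖ = 1 ∧ ‖T x‖ = r}

/-- `T` attains its minimum modulus at some unit vector of its domain. -/
def IsMinAttaining (T : H₁ →ₗ.[ℂ] H₂) : Prop :=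
  ∃ x : T.domain, ‖(x : H₁)‖ = 1 ∧ ‖T x‖ = T.minModulus

/-- `T` is absolutely minimum attaining: for every closed subspace `M` of `H₁`, the restriction
`T|_M : M ∩ D(T) → H₂` is minimum attaining. Subspaces `M` with `M ∩ D(T) = {0}` are left out:
the domain of `T|_M` has no unit vector then, and such `M` exist whenever `D(T) ≠ H₁`. -/
def IsAbsMinAttaining (T : H₁ →ₗ.[ℂ] H₂) : Prop :=
  ∀ M : Submodule ℂ H₁, _root_.IsClosed (M : Set H₁) → M ⊓ T.domain ≠ ⊥ →
    (T.domRestrict M).IsMinAttaining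

/-- The graph of the Moore–Penrose inverse: the pairs `(y, x)` with `x ∈ D(T) ∩ N(T)ᗮ` and
`y - T x ∈ R(T)ᗮ` (i.e. `T x` is the orthogonal projection of `y` onto the closure of `R(T)`). -/
def moorePenroseGraph (T : H₁ →ₗ.[ℂ] H₂) : Submodule ℂ (H₂ × H₁) where
  carrier := {p | p.2 ∈ T.nullSpaceᗮ ∧ ∃ x : T.domain, (x : H₁) = p.2 ∧ p.1 - T x ∈ T.rangeSpaceᗮ}
  zero_mem' := ⟨zero_mem _, 0, rfl, by simp⟩
  add_mem' := by
    rintro ⟨y, _⟩ ⟨y', _⟩ ⟨h, x, rfl, hx⟩ ⟨h', x', rfl, hx'⟩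
    refine ⟨add_mem h h', x + x', rfl, ?_⟩
    have := add_mem hx hx'
    simp only [Prod.fst_add, map_add]
    rwa [add_sub_add_comm]
  smul_mem' := by
    rintro c ⟨y, _⟩ ⟨h, x, rfl, hx⟩
    refine ⟨Submodule.smul_mem _ c h, c • x, rfl, ?_⟩
    have := Submodule.smul_mem _ c hx
    simp only [Prod.smul_fst, map_smul]
    rwa [← smul_sub]

/-- The Moore–Penrose inverse `T†` of `T`, the operator with the graph above. -/
noncomputable def moorePenrose (T : H₁ →ₗ.[ℂ] H₂) : H₂ →ₗ.[ℂ] H₁ :=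
  T.moorePenroseGraph.toLinearPMap

/-- `S ∈ K(H₁, H₂)`: `S` is defined on the whole space and is a compact (continuous linear)
operator there. -/
def IsCompactEverywhere (S : H₁ →ₗ.[ℂ] H₂) : Prop :=
  ∃ K : H₁ →L[ℂ] H₂, IsCompactOperator K ∧ S = (K : H₁ →ₗ[ℂ] H₂).toPMap ⊤

/-- The relation defining `T†` is single-valued, so `T†` really has that graph. -/
theorem mem_graph_moorePenrose (T : H₁ →ₗ.[ℂ] H₂) (y : H₂) (x : H₁) :
    (y, x) ∈ T.moorePenrose.graph ↔
      x ∈ T.nullSpaceᗮ ∧ ∃ z : T.domain, (z : H₁) = x ∧ y - T z ∈ T.rangeSpaceᗮ := by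
  have key : ∀ p ∈ T.moorePenroseGraph, p.1 = 0 → p.2 = 0 := by
    rintro ⟨_, _⟩ ⟨h, z, rfl, hz⟩ rfl
    have h0 : T z = 0 := by
      have h1 : T z ∈ T.rangeSpace := ⟨z, rfl⟩
      have h2 : T z ∈ T.rangeSpaceᗮ := by simpa using hz
      exact inner_self_eq_zero.1 (h2 _ h1)
    exact inner_self_eq_zero.1 (h _ ⟨z, h0, rfl⟩)
  unfold moorePenrose
  rw [Submodule.toLinearPMap_graph_eq _ key]
  rfl

/-- For closed `T`, the domain of `T†` is `R(T) ⊕ R(T)ᗮ`. -/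
theorem moorePenrose_domain [CompleteSpace H₁] (T : H₁ →ₗ.[ℂ] H₂) (hT : T.IsClosed) :
    T.moorePenrose.domain = T.rangeSpace ⊔ T.rangeSpaceᗮ := by
  have hN : _root_.IsClosed (T.nullSpace : Set H₁) := by
    have : (T.nullSpace : Set H₁) = (fun x : H₁ => (x, (0 : H₂))) ⁻¹' (T.graph : Set (H₁ × H₂)) := by
      ext x
      simp [nullSpace, mem_graph_iff, eq_comm]
    rw [this]
    exact hT.preimage (by fun_prop)
  have : CompleteSpace T.nullSpace := hN.completeSpace_coe
  ext y
  rw [mem_domain_iff, Submodule.mem_sup]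
  constructor
  · rintro ⟨x, hx⟩
    obtain ⟨-, z, -, hz⟩ := (T.mem_graph_moorePenrose y x).1 hx
    exact ⟨T z, ⟨z, rfl⟩, _, hz, by abel⟩
  · rintro ⟨_, ⟨z, rfl⟩, w, hw, rfl⟩
    obtain ⟨u, hu, v, hv, huv⟩ := T.nullSpace.exists_add_mem_mem_orthogonal (z : H₁)
    obtain ⟨u', hu', rfl⟩ := hu
    refine ⟨v, (T.mem_graph_moorePenrose _ _).2 ⟨hv, z - u', ?_, ?_⟩⟩
    · simp [huv]
    · have h0 : T u' = 0 := hu'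
      simpa [map_sub, h0] using hw

end LinearPMap

/-! On the graph of `T`, a Hilbert space because `T` is closed, let `A` be the injective projection
`(x, T x) ↦ x`. Since `‖(x, T x)‖² = ‖x‖² + ‖T x‖²`, minimising `‖T x‖ / ‖x‖` over `M ∩ D(T)` is
maximising `‖A g‖ / ‖g‖` over `A⁻¹(M)`. So `T` is absolutely minimum attaining iff `A` attains its
norm on each nonzero `A⁻¹(M)` with `M` closed, and this holds iff `A` is compact.

Compact operators attain their norm on closed subspaces. If `A` is not compact,
`exists_isClosed_forall_not_norm_attaining` builds an orthonormal sequence with orthogonal images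
whose norms increase strictly to an unattained limit; `A` is bounded below on its closed span `K`,
so `M = A(K)` is closed. Unboundedness of `T` says that `A` is not bounded below, which lets these
norms be prescribed.

Finally, `A` is the identity on the copy of `N(T)` in the graph, `T†` is `A` after a bounded
operator, and `x = P x + T† T x` with `P` the projection onto `N(T)`; hence `A` is compact iff
`N(T)` is finite-dimensional and `T†` is compact. -/

/-! ### Norm attainment, and vectors with prescribed image norm. -/

section NormAttaining

open Filter Topology

variable {𝕜 G H : Type*} [RCLike 𝕜]
  [NormedAddCommGroup G] [InnerProductSpace 𝕜 G]
  [NormedAddCommGroup H] [InnerProductSpace 𝕜 H]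

theorem IsCompactOperator.exists_norm_attaining
    [CompleteSpace G] [CompleteSpace H] [Nontrivial G] {A : G →L[𝕜] H}
    (hA : IsCompactOperator A) : ∃ g ≠ 0, ∀ h, ‖A h‖ * ‖g‖ ≤ ‖A g‖ * ‖h‖ := by
  by_cases h0 : A = 0
  · obtain ⟨g, hg⟩ := exists_ne (0 : G)
    exact ⟨g, hg, fun h => by simp [h0]⟩
  have hpos : 0 < ‖A‖ := norm_pos_iff.2 h0
  have hseq : ∀ n : ℕ, ∃ g : G, ‖g‖ ≤ 1 ∧ ‖A‖ - 1 / (n + 1) < ‖A g‖ := by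
    intro n
    obtain ⟨g, hg, hAg⟩ := A.exists_lt_apply_of_lt_opNorm
      (sub_lt_self ‖A‖ (show (0 : ℝ) < 1 / (n + 1) by positivity))
    exact ⟨g, hg.le, hAg⟩
  choose g hg hAg using hseq
  have hcpt := hA.isCompact_closure_image_closedBall (𝕜₁ := 𝕜) (f := (A : G →ₗ[𝕜] H)) 1
  obtain ⟨y, -, φ, hφ, hy⟩ := hcpt.tendsto_subseq (x := fun n => A (g n))
    fun n => subset_closure ⟨g n, by simpa using hg n, rfl⟩
  have hnorm : ‖y‖ = ‖A‖ := by
    refine tendsto_nhds_unique hy.norm ?_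
    have h1 : Tendsto (fun n : ℕ => ‖A‖ - 1 / ((n : ℝ) + 1)) atTop (𝓝 ‖A‖) := by
      simpa using tendsto_const_nhds.sub (tendsto_one_div_add_atTop_nhds_zero_nat (𝕜 := ℝ))
    refine (tendsto_of_tendsto_of_tendsto_of_le_of_le h1 tendsto_const_nhds
      (fun n => (hAg n).le) fun n => ?_).comp hφ.tendsto_atTop
    simpa using A.le_opNorm_of_le (hg n)
  -- `y` is a limit of images of a maximising sequence; two uses of Cauchy–Schwarz show that `A* y`
  -- is a maximiser.
  set z := A.adjoint y with hz
  have hz1 : ‖A‖ ^ 2 ≤ ‖z‖ := by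
    have h1 : Tendsto (fun n => ‖inner 𝕜 z (g (φ n))‖) atTop (𝓝 (‖A‖ ^ 2)) := by
      have : Tendsto (fun n => ‖inner 𝕜 y (A (g (φ n)))‖) atTop (𝓝 ‖inner 𝕜 y y‖) :=
        (tendsto_const_nhds.inner hy).norm
      rw [inner_self_eq_norm_sq_to_K, hnorm] at this
      simpa [hz, A.adjoint_inner_left] using this
    refine le_of_tendsto' h1 fun n => (norm_inner_le_norm _ _).trans ?_
    simpa using mul_le_mul_of_nonneg_left (hg (φ n)) (norm_nonneg z)
  have hz2 : ‖z‖ ^ 2 ≤ ‖A z‖ * ‖A‖ := by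
    have h1 : inner 𝕜 z z = inner 𝕜 y (A z) := by
      conv_lhs => rw [hz]
      rw [A.adjoint_inner_left]
    have h2 : ‖z‖ ^ 2 = ‖inner 𝕜 y (A z)‖ := by
      rw [← h1, inner_self_eq_norm_sq_to_K]; simp
    rw [h2, ← hnorm, mul_comm]
    exact norm_inner_le_norm _ _
  have hz0 : 0 < ‖z‖ := lt_of_lt_of_le (by positivity) hz1
  have hz3 : ‖A‖ * ‖z‖ ≤ ‖A z‖ := by
    have : ‖A‖ * ‖z‖ * ‖A‖ ≤ ‖A z‖ * ‖A‖ := by nlinarith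
    exact le_of_mul_le_mul_right this hpos
  refine ⟨z, norm_pos_iff.1 hz0, fun h => ?_⟩
  calc ‖A h‖ * ‖z‖ ≤ ‖A‖ * ‖h‖ * ‖z‖ := by gcongr; exact A.le_opNorm h
    _ = ‖A‖ * ‖z‖ * ‖h‖ := by ring
    _ ≤ ‖A z‖ * ‖h‖ := by gcongr

theorem IsCompactOperator.exists_norm_attaining_on
    [CompleteSpace G] [CompleteSpace H] {A : G →L[𝕜] H}
    (hA : IsCompactOperator A) {K : Submodule 𝕜 G} (hK : IsClosed (K : Set G)) (hK0 : K ≠ ⊥) :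
    ∃ g ∈ K, g ≠ 0 ∧ ∀ h ∈ K, ‖A h‖ * ‖g‖ ≤ ‖A g‖ * ‖h‖ := by
  have := hK.completeSpace_coe
  have := Submodule.nontrivial_iff_ne_bot.2 hK0
  obtain ⟨g, hg, hmax⟩ := IsCompactOperator.exists_norm_attaining
    (A := A ∘L K.subtypeL) (hA.comp_clm K.subtypeL)
  exact ⟨g, g.2, by simpa using hg, fun h hh => hmax ⟨h, hh⟩⟩

/-- Otherwise `A` would be a norm limit of the finite-rank operators `A P_F`. -/
theorem ContinuousLinearMap.exists_forall_finiteDimensional_of_not_isCompactOperator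
    [CompleteSpace H] {A : G →L[𝕜] H} (hA : ¬ IsCompactOperator A) :
    ∃ c > 0, ∀ F : Submodule 𝕜 G, FiniteDimensional 𝕜 F → ∃ g ∈ Fᗮ, ‖g‖ = 1 ∧ c ≤ ‖A g‖ := by
  by_contra! hcon
  refine hA ?_
  have h1 : ∀ n : ℕ, ∃ F : Submodule 𝕜 G, FiniteDimensional 𝕜 F ∧
      ∀ g ∈ Fᗮ, ‖g‖ = 1 → ‖A g‖ < 1 / (n + 1) := fun n => hcon _ (by positivity)
  choose F hF hFA using h1
  refine isCompactOperator_of_tendsto (l := atTop) (F := fun n => A ∘L (F n).starProjection)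
    (f := A) ?_ (.of_forall fun n => ?_)
  · rw [tendsto_iff_norm_sub_tendsto_zero]
    refine squeeze_zero (fun _ => norm_nonneg _) (fun n => ?_)
      (tendsto_one_div_add_atTop_nhds_zero_nat (𝕜 := ℝ))
    refine ContinuousLinearMap.opNorm_le_bound _ (by positivity) fun x => ?_
    set w := x - (F n).starProjection x with hw
    have hwmem : w ∈ (F n)ᗮ := (F n).sub_starProjection_mem_orthogonal x
    have hwx : ‖w‖ ≤ ‖x‖ := by
      rw [hw, ← Submodule.starProjection_orthogonal_val]
      exact Submodule.norm_starProjection_apply_le _ _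
    have hsub : (A ∘L (F n).starProjection - A) x = -A w := by simp [hw]
    rw [hsub, norm_neg]
    rcases eq_or_ne w 0 with h0 | h0
    · simp only [h0, map_zero, norm_zero]; positivity
    · have h2 := hFA n ((‖w‖⁻¹ : 𝕜) • w) (Submodule.smul_mem _ _ hwmem) (norm_smul_inv_norm h0)
      rw [map_smul, norm_smul, norm_inv, RCLike.norm_ofReal, abs_norm,
        inv_mul_lt_iff₀ (norm_pos_iff.2 h0)] at h2
      calc ‖A w‖ ≤ ‖w‖ * (1 / (n + 1)) := h2.le
        _ ≤ 1 / (n + 1) * ‖x‖ := by rw [mul_comm]; gcongr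
  · have : IsCompactOperator ((F n).orthogonalProjectionOnto : G →L[𝕜] F n) := by
      have := FiniteDimensional.proper 𝕜 (F n)
      exact isCompactOperator_of_locallyCompactSpace_dom _
    exact this.clm_comp (A ∘L (F n).subtypeL)

/-- If `A` were bounded below on `Fᗮ`, then `A(Fᗮ)` would be closed, and so would `A(Fᗮ) + A(F)`,
the whole range; an injective operator with closed range is bounded below. -/
theorem ContinuousLinearMap.exists_mem_orthogonal_norm_apply_le
    [CompleteSpace G] [CompleteSpace H] {A : G →L[𝕜] H}
    (hinj : Function.Injective A) (hA : ∀ C, ¬ AntilipschitzWith C A)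
    (F : Submodule 𝕜 G) [FiniteDimensional 𝕜 F] {c : ℝ} (hc : 0 < c) :
    ∃ g ∈ Fᗮ, ‖g‖ = 1 ∧ ‖A g‖ ≤ c := by
  by_contra! hcon
  have hanti : AntilipschitzWith (c⁻¹).toNNReal (A ∘L Fᗮ.subtypeL) := by
    refine AddMonoidHomClass.antilipschitz_of_bound _ fun x => ?_
    rw [Real.coe_toNNReal _ (by positivity)]
    rcases eq_or_ne x 0 with h0 | h0
    · simp [h0]
    have h0' : (x : G) ≠ 0 := by simpa using h0
    have h2 := hcon ((‖(x : G)‖⁻¹ : 𝕜) • (x : G)) (Submodule.smul_mem _ _ x.2)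
      (norm_smul_inv_norm h0')
    rw [map_smul, norm_smul, norm_inv, RCLike.norm_ofReal, abs_norm,
      lt_inv_mul_iff₀ (norm_pos_iff.2 h0')] at h2
    rw [← div_eq_inv_mul, le_div_iff₀ hc]
    exact h2.le
  have hcl : IsClosed ((Fᗮ.map (A : G →ₗ[𝕜] H) : Submodule 𝕜 H) : Set H) := by
    have := hanti.isClosed_range (A ∘L Fᗮ.subtypeL).uniformContinuous
    convert this using 1
    ext y
    simp
  have hfin : FiniteDimensional 𝕜 (F.map (A : G →ₗ[𝕜] H)) := inferInstance
  have hsup := Submodule.isClosed_sup_finiteDimensional _ (F.map (A : G →ₗ[𝕜] H)) hcl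
  rw [← Submodule.map_sup, sup_comm, Submodule.sup_orthogonal_of_hasOrthogonalProjection,
    Submodule.map_top] at hsup
  obtain ⟨C, hC⟩ := A.antilipschitz_of_injective_of_isClosed_range hinj 
    (by rwa [LinearMap.coe_range] at hsup)
  exact hA C hC

theorem ContinuousLinearMap.exists_norm_eq_one_norm_apply_eq {A : G →L[𝕜] H}
    {V : Submodule 𝕜 G} {u v : G} (hu : u ∈ V) (hv : v ∈ V) (hu1 : ‖u‖ = 1) (hv1 : ‖v‖ = 1)
    {c : ℝ} (hcu : ‖A u‖ ≤ c) (hcv : c ≤ ‖A v‖) : ∃ g ∈ V, ‖g‖ = 1 ∧ ‖A g‖ = c := by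
  let p : ℝ → G := fun t => ((1 - t : ℝ) : 𝕜) • u + (t : 𝕜) • v
  have hp : Continuous p := by fun_prop
  obtain ⟨t, ht, ht0⟩ := intermediate_value_Icc (zero_le_one' ℝ)
    (f := fun t => ‖A (p t)‖ - c * ‖p t‖) (by fun_prop)
    (show (0 : ℝ) ∈ Set.Icc _ _ by simp [p, hu1, hv1, hcu, hcv])
  have hpV : p t ∈ V := V.add_mem (V.smul_mem _ hu) (V.smul_mem _ hv)
  rcases eq_or_ne (p t) 0 with h0 | h0
  -- The segment meets `0` only when `u = -v`; then `‖A u‖ = ‖A v‖` and `v` itself works.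
  · have h1 : ((1 - t : ℝ) : 𝕜) • u = -((t : 𝕜) • v) := eq_neg_of_add_eq_zero_left h0
    have h2 : 1 - t = t := by
      have := congrArg norm h1
      rwa [norm_neg, norm_smul, norm_smul, hu1, hv1, RCLike.norm_ofReal, RCLike.norm_ofReal,
        mul_one, mul_one, abs_of_nonneg (by linarith [ht.2]), abs_of_nonneg ht.1] at this
    have ht' : (t : 𝕜) ≠ 0 := by
      have : t ≠ 0 := by intro h; simp [h] at h2
      exact_mod_cast this
    have h3 : u = -v := by
      rw [h2, ← smul_neg] at h1
      exact smul_right_injective G ht' h1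
    refine ⟨v, hv, hv1, le_antisymm ?_ hcv⟩
    simpa [h3] using hcu
  · refine ⟨(‖p t‖⁻¹ : 𝕜) • p t, V.smul_mem _ hpV, norm_smul_inv_norm h0, ?_⟩
    rw [map_smul, norm_smul, norm_inv, RCLike.norm_ofReal, abs_norm]
    have := norm_pos_iff.2 h0
    have h4 : ‖A (p t)‖ = c * ‖p t‖ := sub_eq_zero.1 ht0
    rw [h4]; field_simp

end NormAttaining

/-! ### Orthonormal systems with orthogonal images, and least squares inverses. -/

section OrthogonalSystem

open Filter Topology

variable {𝕜 G H : Type*} [RCLike 𝕜]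
  [NormedAddCommGroup G] [InnerProductSpace 𝕜 G]
  [NormedAddCommGroup H] [InnerProductSpace 𝕜 H]

theorem norm_sum_sq_of_pairwise_inner_eq_zero {ι : Type*} {v : ι → G}
    (hv : Pairwise fun i j => inner 𝕜 (v i) (v j) = 0) (s : Finset ι) :
    ‖∑ i ∈ s, v i‖ ^ 2 = ∑ i ∈ s, ‖v i‖ ^ 2 := by
  classical
  induction s using Finset.induction_on with
  | empty => simp
  | insert a s ha ih =>
    have h0 : inner 𝕜 (v a) (∑ i ∈ s, v i) = 0 := by
      rw [inner_sum]
      exact Finset.sum_eq_zero fun i hi => hv fun h => ha (h ▸ hi)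
    rw [Finset.sum_insert ha, Finset.sum_insert ha, norm_add_sq (𝕜 := 𝕜), h0, ih]
    simp

theorem Orthonormal.norm_apply_bounds {ι : Type*} {g : ι → G} (hg : Orthonormal 𝕜 g)
    {A : G →L[𝕜] H} (hA : Pairwise fun i j => inner 𝕜 (A (g i)) (A (g j)) = 0) {a c : ℝ}
    (ha : 0 ≤ a) (hc : 0 ≤ c) (hag : ∀ i, a ≤ ‖A (g i)‖) (hgc : ∀ i, ‖A (g i)‖ ≤ c) {k : G}
    (hk : k ∈ (Submodule.span 𝕜 (Set.range g)).topologicalClosure) :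
    a * ‖k‖ ≤ ‖A k‖ ∧ ‖A k‖ ≤ c * ‖k‖ := by
  have hcl : IsClosed {k : G | a * ‖k‖ ≤ ‖A k‖ ∧ ‖A k‖ ≤ c * ‖k‖} :=
    (isClosed_le (f := fun k => a * ‖k‖) (g := fun k => ‖A k‖) (by fun_prop) (by fun_prop)).inter
      (isClosed_le (f := fun k => ‖A k‖) (g := fun k => c * ‖k‖) (by fun_prop) (by fun_prop))
  refine closure_minimal (fun x hx => ?_) hcl hk
  obtain ⟨l, rfl⟩ := Finsupp.mem_span_range_iff_exists_finsupp.1 hx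
  have h1 : ‖l.sum fun i b => b • g i‖ ^ 2 = ∑ i ∈ l.support, ‖l i‖ ^ 2 := by
    rw [Finsupp.sum, norm_sum_sq_of_pairwise_inner_eq_zero (𝕜 := 𝕜) fun i j hij => ?_]
    · simp [norm_smul, hg.1]
    · simp [inner_smul_left, inner_smul_right, hg.2 hij]
  have h2 : ‖A (l.sum fun i b => b • g i)‖ ^ 2 =
      ∑ i ∈ l.support, ‖l i‖ ^ 2 * ‖A (g i)‖ ^ 2 := by
    rw [Finsupp.sum, map_sum, norm_sum_sq_of_pairwise_inner_eq_zero (𝕜 := 𝕜) fun i j hij => ?_]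
    · simp [norm_smul, mul_pow]
    · simp [inner_smul_left, inner_smul_right, hA hij]
  constructor
  · refine le_of_sq_le_sq ?_ (norm_nonneg _)
    rw [mul_pow, h1, h2, Finset.mul_sum]
    refine Finset.sum_le_sum fun i _ => ?_
    rw [mul_comm]
    gcongr
    exact hag i
  · refine le_of_sq_le_sq ?_ (by positivity)
    rw [mul_pow, h1, h2, Finset.mul_sum]
    refine Finset.sum_le_sum fun i _ => ?_
    rw [mul_comm]
    gcongr
    exact hgc i

/-- Some coordinate of `k` along a `g i` is nonzero. Splitting it off is orthogonal both before and
after applying `A`, and that component alone makes the bound strict. -/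
theorem Orthonormal.norm_apply_lt {ι : Type*} {g : ι → G} (hg : Orthonormal 𝕜 g)
    {A : G →L[𝕜] H} (hA : Pairwise fun i j => inner 𝕜 (A (g i)) (A (g j)) = 0) {c : ℝ}
    (hc : 0 ≤ c) (hgc : ∀ i, ‖A (g i)‖ < c) {k : G}
    (hk : k ∈ (Submodule.span 𝕜 (Set.range g)).topologicalClosure) (hk0 : k ≠ 0) :
    ‖A k‖ < c * ‖k‖ := by
  set K := (Submodule.span 𝕜 (Set.range g)).topologicalClosure with hK
  have hgK : ∀ i, g i ∈ K := fun i =>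
    Submodule.le_topologicalClosure _ (Submodule.subset_span ⟨i, rfl⟩)
  have hinner : ∀ i, ∀ x ∈ K,
      inner 𝕜 (A (g i)) (A x) = (‖A (g i)‖ : 𝕜) ^ 2 * inner 𝕜 (g i) x := by
    intro i x hx
    have hcl : IsClosed {x : G | inner 𝕜 (A (g i)) (A x) =
        (‖A (g i)‖ : 𝕜) ^ 2 * inner 𝕜 (g i) x} := isClosed_eq (by fun_prop) (by fun_prop)
    refine closure_minimal (fun x hx => ?_) hcl hx
    induction hx using Submodule.span_induction with
    | mem x hx =>
      obtain ⟨j, rfl⟩ := hx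
      rcases eq_or_ne i j with rfl | hij
      · simp [inner_self_eq_norm_sq_to_K, hg.1]
      · simp [hA hij, hg.2 hij]
    | zero => simp
    | add x y _ _ hx hy =>
      simp only [Set.mem_ofPred_eq] at hx hy ⊢
      simp [inner_add_right, hx, hy, mul_add]
    | smul b x _ hx =>
      simp only [Set.mem_ofPred_eq] at hx ⊢
      simp [inner_smul_right, hx]
      ring
  obtain ⟨i, hi⟩ : ∃ i, inner 𝕜 (g i) k ≠ 0 := by
    by_contra! hcon
    have h1 : k ∈ Kᗮ := by
      rw [hK, Submodule.orthogonal_closure, Submodule.mem_orthogonal]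
      intro u hu
      induction hu using Submodule.span_induction with
      | mem x hx => obtain ⟨j, rfl⟩ := hx; exact hcon j
      | zero => simp
      | add x y _ _ hx hy => simp [inner_add_left, hx, hy]
      | smul b x _ hx => simp [inner_smul_left, hx]
    exact hk0 (inner_self_eq_zero.1 (h1 k hk))
  set b := inner 𝕜 (g i) k with hb
  set w := k - b • g i with hw
  have hwK : w ∈ K := K.sub_mem hk (K.smul_mem _ (hgK i))
  have hwi : inner 𝕜 (g i) w = 0 := by
    simp [hw, inner_sub_right, inner_smul_right, inner_self_eq_norm_sq_to_K, hg.1, ← hb]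
  have hAw : inner 𝕜 (A (g i)) (A w) = 0 := by rw [hinner i w hwK, hwi, mul_zero]
  have hkw : k = b • g i + w := by simp [hw]
  have h1 : ‖k‖ ^ 2 = ‖b‖ ^ 2 + ‖w‖ ^ 2 := by
    rw [hkw, norm_add_sq (𝕜 := 𝕜), inner_smul_left, hwi]
    simp [norm_smul, hg.1]
  have h2 : ‖A k‖ ^ 2 = ‖b‖ ^ 2 * ‖A (g i)‖ ^ 2 + ‖A w‖ ^ 2 := by
    rw [hkw, map_add, map_smul, norm_add_sq (𝕜 := 𝕜), inner_smul_left, hAw]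
    simp [norm_smul, mul_pow]
  have h3 : ‖A w‖ ^ 2 ≤ c ^ 2 * ‖w‖ ^ 2 := by
    rw [← mul_pow]
    gcongr
    exact (hg.norm_apply_bounds hA le_rfl hc (fun _ => norm_nonneg _)
      (fun i => (hgc i).le) hwK).2
  have h4 : ‖A (g i)‖ ^ 2 < c ^ 2 := by
    gcongr
    exact hgc i
  have h5 : 0 < ‖b‖ ^ 2 := by have := norm_pos_iff.2 hi; positivity
  refine lt_of_pow_lt_pow_left₀ 2 (by positivity) ?_
  rw [mul_pow, h1, h2]
  nlinarith

theorem ContinuousLinearMap.exists_orthonormal_sequence [CompleteSpace G] [CompleteSpace H]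
    {A : G →L[𝕜] H} {γ : ℕ → ℝ}
    (h : ∀ (F : Submodule 𝕜 G) (n : ℕ), FiniteDimensional 𝕜 F →
      ∃ g ∈ Fᗮ, ‖g‖ = 1 ∧ ‖A g‖ = γ n) :
    ∃ (g : ℕ → G) (φ : ℕ → ℕ), StrictMono φ ∧ Orthonormal 𝕜 g ∧
      (Pairwise fun i j => inner 𝕜 (A (g i)) (A (g j)) = 0) ∧ ∀ n, ‖A (g n)‖ = γ (φ n) := by
  classical
  obtain ⟨f, hf, hfr⟩ := exists_seq_of_forall_finset_exists
    (fun p : ℕ × G => ‖p.2‖ = 1 ∧ ‖A p.2‖ = γ p.1)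
    (fun p q => p.1 < q.1 ∧ inner 𝕜 p.2 q.2 = 0 ∧ inner 𝕜 (A p.2) (A q.2) = 0) fun s _ => by
      -- Orthogonality to `A* A p` gives orthogonality of the images; the index `sup + 1` below
      -- makes `φ` strictly increasing.
      let S : Finset G := s.image Prod.snd ∪ s.image fun p => A.adjoint (A p.2)
      obtain ⟨g, hgF, hg1, hg2⟩ := h (Submodule.span 𝕜 (S : Set G)) (s.sup Prod.fst + 1)
        (FiniteDimensional.span_finset 𝕜 S)
      have hS : ∀ x ∈ S, inner 𝕜 x g = 0 := fun x hx => hgF x (Submodule.subset_span hx)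
      refine ⟨(s.sup Prod.fst + 1, g), ⟨hg1, hg2⟩, fun p hp => ⟨?_, ?_, ?_⟩⟩
      · exact Nat.lt_succ_of_le (Finset.le_sup (f := Prod.fst) hp)
      · exact hS _ (Finset.mem_union_left _ (Finset.mem_image_of_mem _ hp))
      · rw [← A.adjoint_inner_left]
        exact hS _ (Finset.mem_union_right _ (Finset.mem_image_of_mem _ hp))
  refine ⟨fun n => (f n).2, fun n => (f n).1, fun m n hmn => (hfr m n hmn).1,
    ⟨fun n => (hf n).1, fun i j hij => ?_⟩, fun i j hij => ?_, fun n => (hf n).2⟩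
  · rcases lt_or_gt_of_ne hij with h | h
    · exact (hfr _ _ h).2.1
    · exact inner_eq_zero_symm.1 (hfr _ _ h).2.1
  · rcases lt_or_gt_of_ne hij with h | h
    · exact (hfr _ _ h).2.2
    · exact inner_eq_zero_symm.1 (hfr _ _ h).2.2

theorem ContinuousLinearMap.exists_isClosed_forall_not_norm_attaining
    [CompleteSpace G] [CompleteSpace H] {A : G →L[𝕜] H} (hinj : Function.Injective A)
    (hanti : ∀ C, ¬ AntilipschitzWith C A) (hA : ¬ IsCompactOperator A) :
    ∃ M : Submodule 𝕜 H, IsClosed (M : Set H) ∧ M.comap (A : G →ₗ[𝕜] H) ≠ ⊥ ∧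
      ∀ k, A k ∈ M → k ≠ 0 → ∃ h, A h ∈ M ∧ ‖A k‖ * ‖h‖ < ‖A h‖ * ‖k‖ := by
  obtain ⟨c, hc, hcA⟩ :=
    ContinuousLinearMap.exists_forall_finiteDimensional_of_not_isCompactOperator hA
  -- These values lie in `[c/2, c)`: the limit `c` is not attained, and the lower bound `c/2` keeps
  -- `A(K)` closed.
  let γ : ℕ → ℝ := fun n => c - c / 2 * (1 / ((n : ℝ) + 1))
  have hγc : ∀ n, γ n < c := fun n => sub_lt_self _ (by positivity)
  have hγ0 : ∀ n, c / 2 ≤ γ n := by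
    intro n
    have : 1 / ((n : ℝ) + 1) ≤ 1 := by
      rw [div_le_one (by positivity)]
      linarith [(Nat.cast_nonneg n : (0 : ℝ) ≤ n)]
    show c / 2 ≤ c - c / 2 * (1 / ((n : ℝ) + 1))
    nlinarith
  have hγ : Tendsto γ atTop (𝓝 c) := by
    have h := (tendsto_const_nhds (x := c)).sub
      ((tendsto_one_div_add_atTop_nhds_zero_nat (𝕜 := ℝ)).const_mul (c / 2))
    rwa [mul_zero, sub_zero] at h
  obtain ⟨g, φ, hφ, hg, hAg, hgγ⟩ :=
    ContinuousLinearMap.exists_orthonormal_sequence (A := A) (γ := γ) fun F n hF => by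
      obtain ⟨u, hu, hu1, hAu⟩ := ContinuousLinearMap.exists_mem_orthogonal_norm_apply_le hinj
        hanti F (half_pos hc)
      obtain ⟨v, hv, hv1, hAv⟩ := hcA F hF
      exact ContinuousLinearMap.exists_norm_eq_one_norm_apply_eq hu hv hu1 hv1
        (hAu.trans (hγ0 n)) ((hγc n).le.trans hAv)
  set K := (Submodule.span 𝕜 (Set.range g)).topologicalClosure with hK
  have hgK : ∀ i, g i ∈ K := fun i =>
    Submodule.le_topologicalClosure _ (Submodule.subset_span ⟨i, rfl⟩)
  have hKcl : IsClosed (K : Set G) := Submodule.isClosed_topologicalClosure _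
  have := hKcl.completeSpace_coe
  have hKanti : AntilipschitzWith ((c / 2)⁻¹).toNNReal (A ∘L K.subtypeL) := by
    refine AddMonoidHomClass.antilipschitz_of_bound _ fun x => ?_
    rw [Real.coe_toNNReal _ (by positivity), ← div_eq_inv_mul, le_div_iff₀ (half_pos hc), mul_comm]
    exact (hg.norm_apply_bounds hAg (half_pos hc).le hc.le (fun n => hgγ n ▸ hγ0 _)
      (fun n => hgγ n ▸ (hγc _).le) x.2).1
  -- Injectivity ensures that pulling `M = A(K)` back gives no more than `K`.
  have hMK : ∀ k, A k ∈ K.map (A : G →ₗ[𝕜] H) → k ∈ K := by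
    rintro k ⟨k', hk', hkk⟩
    exact hinj hkk ▸ hk'
  refine ⟨K.map (A : G →ₗ[𝕜] H), ?_, ?_, fun k hk hk0 => ?_⟩
  · convert hKanti.isClosed_range (A ∘L K.subtypeL).uniformContinuous using 1
    ext y
    simp
  · refine (Submodule.ne_bot_iff _).2 ⟨g 0, ⟨g 0, hgK 0, rfl⟩, ?_⟩
    exact norm_ne_zero_iff.1 (by simp [hg.1 0])
  · have hlt := hg.norm_apply_lt hAg hc.le (fun n => hgγ n ▸ hγc _) (hMK k hk) hk0
    by_contra! hcon
    have hle : ∀ n, γ (φ n) * ‖k‖ ≤ ‖A k‖ := fun n => by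
      have := hcon (g n) ⟨g n, hgK n, rfl⟩
      rwa [hgγ, hg.1 n, mul_one] at this
    have hlim := le_of_tendsto' ((hγ.comp hφ.tendsto_atTop).mul_const ‖k‖) hle
    exact absurd hlim hlt.not_ge

/-- An operator that is bounded below has a bounded least squares inverse. -/
theorem AntilipschitzWith.exists_leastSquares_inverse [CompleteSpace G] [CompleteSpace H]
    {B : G →L[𝕜] H} {C : NNReal} (hB : AntilipschitzWith C B) :
    ∃ L : H →L[𝕜] G, ∀ y x, inner 𝕜 (B x) (y - B (L y)) = 0 := by
  have hcl : IsClosed (Set.range B) := hB.isClosed_range B.uniformContinuous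
  have hclR : IsClosed (B.range : Set H) := by
    rwa [LinearMap.coe_range]
  have := hclR.completeSpace_coe
  let e := B.equivRange hB.injective hcl
  refine ⟨e.symm.toContinuousLinearMap ∘L B.range.orthogonalProjectionOnto, fun y x => ?_⟩
  have h : B (e.symm (B.range.orthogonalProjectionOnto y)) = B.range.starProjection y :=
    congrArg Subtype.val (e.apply_symm_apply (B.range.orthogonalProjectionOnto y))
  have h2 := B.range.sub_starProjection_mem_orthogonal y (B x) ⟨x, rfl⟩
  rwa [← h] at h2

/-- An operator that is bounded below on a closed subspace `K` has a bounded least squares inverse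
with values in `K`. -/
theorem ContinuousLinearMap.exists_leastSquares_inverse_on [CompleteSpace G] [CompleteSpace H]
    (B : G →L[𝕜] H) {K : Submodule 𝕜 G} (hK : IsClosed (K : Set G)) {C : ℝ} (hC : 0 ≤ C)
    (hB : ∀ g ∈ K, ‖g‖ ≤ C * ‖B g‖) :
    ∃ L : H →L[𝕜] G, ∀ y, L y ∈ K ∧ ∀ x ∈ K, inner 𝕜 (B x) (y - B (L y)) = 0 := by
  have := hK.completeSpace_coe
  have hanti : AntilipschitzWith C.toNNReal (B ∘L K.subtypeL) := by
    refine AddMonoidHomClass.antilipschitz_of_bound _ fun x => ?_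
    rw [Real.coe_toNNReal _ hC]
    exact hB x x.2
  obtain ⟨L, hL⟩ := hanti.exists_leastSquares_inverse
  exact ⟨K.subtypeL ∘L L, fun y => ⟨(L y).2, fun x hx => hL y ⟨x, hx⟩⟩⟩

end OrthogonalSystem

/-! ### Translation to the graph of `T`. -/

namespace LinearPMap

variable {H₁ H₂ : Type*}
  [NormedAddCommGroup H₁] [InnerProductSpace ℂ H₁]
  [NormedAddCommGroup H₂] [InnerProductSpace ℂ H₂]

/-- The graph of `T`, as a subspace of the Hilbert sum of `H₁` and `H₂`. -/
def hilbertGraph (T : H₁ →ₗ.[ℂ] H₂) : Submodule ℂ (WithLp 2 (H₁ × H₂)) :=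
  T.graph.comap (WithLp.linearEquiv 2 ℂ (H₁ × H₂)).toLinearMap

/-- The first projection `(x, T x) ↦ x` on the graph of `T`. -/
noncomputable def graphFst (T : H₁ →ₗ.[ℂ] H₂) : T.hilbertGraph →L[ℂ] H₁ :=
  WithLp.fstL 2 ℂ H₁ H₂ ∘L T.hilbertGraph.subtypeL

/-- The second projection `(x, T x) ↦ T x` on the graph of `T`. -/
noncomputable def graphSnd (T : H₁ →ₗ.[ℂ] H₂) : T.hilbertGraph →L[ℂ] H₂ :=
  WithLp.sndL 2 ℂ H₁ H₂ ∘L T.hilbertGraph.subtypeL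

/-- The point `(x, T x)` of the graph of `T`. -/
def graphMk (T : H₁ →ₗ.[ℂ] H₂) (x : T.domain) : T.hilbertGraph :=
  ⟨WithLp.toLp 2 ((x : H₁), T x), T.mem_graph x⟩

@[simp]
theorem graphFst_graphMk (T : H₁ →ₗ.[ℂ] H₂) (x : T.domain) : T.graphFst (T.graphMk x) = x := rfl

@[simp]
theorem graphSnd_graphMk (T : H₁ →ₗ.[ℂ] H₂) (x : T.domain) : T.graphSnd (T.graphMk x) = T x := rfl

theorem graphMk_surjective (T : H₁ →ₗ.[ℂ] H₂) : Function.Surjective T.graphMk := by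
  rintro ⟨g, hg⟩
  obtain ⟨x, hx⟩ := T.mem_graph_iff'.1 hg
  exact ⟨x, Subtype.ext ((WithLp.linearEquiv 2 ℂ (H₁ × H₂)).injective hx)⟩

theorem graphFst_injective (T : H₁ →ₗ.[ℂ] H₂) : Function.Injective T.graphFst := by
  intro g h hgh
  obtain ⟨x, rfl⟩ := T.graphMk_surjective g
  obtain ⟨y, rfl⟩ := T.graphMk_surjective h
  exact congrArg T.graphMk (Subtype.ext hgh)

theorem norm_graphMk_sq (T : H₁ →ₗ.[ℂ] H₂) (x : T.domain) :
    ‖T.graphMk x‖ ^ 2 = ‖(x : H₁)‖ ^ 2 + ‖T x‖ ^ 2 :=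
  WithLp.prod_norm_sq_eq_of_L2 _

theorem IsClosed.isClosed_hilbertGraph {T : H₁ →ₗ.[ℂ] H₂} (hT : T.IsClosed) :
    _root_.IsClosed (T.hilbertGraph : Set (WithLp 2 (H₁ × H₂))) :=
  hT.preimage (WithLp.prodContinuousLinearEquiv 2 ℂ H₁ H₂).continuous

theorem isBounded_of_antilipschitzWith_graphFst {T : H₁ →ₗ.[ℂ] H₂} {C : NNReal}
    (h : AntilipschitzWith C T.graphFst) : T.IsBounded := by
  refine ⟨C, fun x => le_trans ?_ (ZeroHomClass.bound_of_antilipschitz _ h (T.graphMk x))⟩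
  refine le_of_sq_le_sq ?_ (norm_nonneg _)
  rw [norm_graphMk_sq]
  nlinarith [sq_nonneg ‖(x : H₁)‖]

theorem isMinAttaining_iff {T : H₁ →ₗ.[ℂ] H₂} :
    T.IsMinAttaining ↔
      ∃ x : T.domain, (x : H₁) ≠ 0 ∧ ∀ y : T.domain, ‖T x‖ * ‖(y : H₁)‖ ≤ ‖T y‖ * ‖(x : H₁)‖ := by
  have hscale : ∀ y : T.domain, (y : H₁) ≠ 0 →
      ‖(((‖(y : H₁)‖⁻¹ : ℂ) • y : T.domain) : H₁)‖ = 1 ∧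
      ‖T ((‖(y : H₁)‖⁻¹ : ℂ) • y)‖ = ‖(y : H₁)‖⁻¹ * ‖T y‖ := by
    intro y hy
    refine ⟨norm_smul_inv_norm hy, ?_⟩
    rw [map_smul, norm_smul, norm_inv, Complex.norm_real, norm_norm]
  constructor
  · rintro ⟨x, hx, hTx⟩
    refine ⟨x, norm_ne_zero_iff.1 (by simp [hx]), fun y => ?_⟩
    rcases eq_or_ne (y : H₁) 0 with h0 | h0
    · simp only [h0, norm_zero, mul_zero]; positivity
    obtain ⟨h1, h2⟩ := hscale y h0
    have h3 : ‖T x‖ ≤ ‖(y : H₁)‖⁻¹ * ‖T y‖ := by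
      rw [hTx]
      refine csInf_le ⟨0, ?_⟩ ⟨_, h1, h2⟩
      rintro _ ⟨z, -, rfl⟩
      exact norm_nonneg _
    rwa [← div_eq_inv_mul, le_div_iff₀ (norm_pos_iff.2 h0), ← mul_one ‖T y‖, ← hx] at h3
  · rintro ⟨x, hx0, hx⟩
    obtain ⟨h1, h2⟩ := hscale x hx0
    refine ⟨_, h1, Eq.symm ?_⟩
    refine IsLeast.csInf_eq ⟨⟨_, h1, rfl⟩, ?_⟩
    rintro _ ⟨y, hy, rfl⟩
    have := hx y
    rw [hy, mul_one] at this
    rwa [h2, ← div_eq_inv_mul, div_le_iff₀ (norm_pos_iff.2 hx0)]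

/-- After squaring, the two inequalities differ by the common term `‖x‖² ‖y‖²`. -/
theorem mul_norm_graphMk_le_iff (T : H₁ →ₗ.[ℂ] H₂) (x y : T.domain) :
    ‖T.graphFst (T.graphMk y)‖ * ‖T.graphMk x‖ ≤ ‖T.graphFst (T.graphMk x)‖ * ‖T.graphMk y‖ ↔
      ‖T x‖ * ‖(y : H₁)‖ ≤ ‖T y‖ * ‖(x : H₁)‖ := by
  rw [← sq_le_sq₀ (by positivity) (by positivity),
    ← sq_le_sq₀ (a := ‖T x‖ * ‖(y : H₁)‖) (by positivity) (by positivity)]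
  simp only [mul_pow, norm_graphMk_sq, graphFst_graphMk]
  constructor <;> intro h <;> linarith

theorem isAbsMinAttaining_iff {T : H₁ →ₗ.[ℂ] H₂} :
    T.IsAbsMinAttaining ↔ ∀ M : Submodule ℂ H₁, _root_.IsClosed (M : Set H₁) →
      M.comap (T.graphFst : T.hilbertGraph →ₗ[ℂ] H₁) ≠ ⊥ →
      ∃ k, T.graphFst k ∈ M ∧ k ≠ 0 ∧
        ∀ h, T.graphFst h ∈ M → ‖T.graphFst h‖ * ‖k‖ ≤ ‖T.graphFst k‖ * ‖h‖ := by
  refine forall_congr' fun M => forall_congr' fun _ => imp_congr (not_congr ?_) ?_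
  · rw [Submodule.eq_bot_iff, Submodule.eq_bot_iff]
    constructor
    · intro h k hk
      obtain ⟨x, rfl⟩ := T.graphMk_surjective k
      exact T.graphFst_injective ((h x ⟨hk, x.2⟩).trans (_root_.map_zero T.graphFst).symm)
    · rintro h x ⟨hxM, hxT⟩
      simpa using congrArg T.graphFst (h (T.graphMk ⟨x, hxT⟩) hxM)
  · rw [isMinAttaining_iff]
    have hres : ∀ (z : (T.domRestrict M).domain) (x : T.domain), (z : H₁) = x →
        T.domRestrict M z = T x := fun _ _ h => domRestrict_apply h
    constructor
    · rintro ⟨⟨x, hx⟩, hx0, hmin⟩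
      refine ⟨T.graphMk ⟨x, hx.2⟩, hx.1, fun h => hx0 (by simpa using congrArg T.graphFst h),
        fun h hh => ?_⟩
      obtain ⟨y, rfl⟩ := T.graphMk_surjective h
      rw [mul_norm_graphMk_le_iff]
      have := hmin ⟨y, hh, y.2⟩
      rwa [hres _ ⟨x, hx.2⟩ rfl, hres _ y rfl] at this
    · rintro ⟨k, hk, hk0, hmax⟩
      obtain ⟨x, rfl⟩ := T.graphMk_surjective k
      refine ⟨⟨x, hk, x.2⟩, fun h => hk0 (T.graphFst_injective (by simpa using h)), fun y => ?_⟩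
      rw [hres _ x rfl, hres y ⟨y, y.2.2⟩ rfl]
      exact (T.mul_norm_graphMk_le_iff x ⟨y, y.2.2⟩).1 (hmax (T.graphMk ⟨y, y.2.2⟩) y.2.1)

theorem IsClosed.isClosed_nullSpace {T : H₁ →ₗ.[ℂ] H₂} (hT : T.IsClosed) :
    _root_.IsClosed (T.nullSpace : Set H₁) := by
  have : (T.nullSpace : Set H₁) =
      (fun x : H₁ => (x, (0 : H₂))) ⁻¹' (T.graph : Set (H₁ × H₂)) := by
    ext x
    simp [nullSpace, mem_graph_iff, eq_comm]
  rw [this]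
  exact hT.preimage (by fun_prop)

/-! ### Compactness of the graph projection, `N(T)` and `T†`. -/

section Closed

variable {T : H₁ →ₗ.[ℂ] H₂}

theorem IsClosed.isAbsMinAttaining_iff_isCompactOperator_graphFst
    [CompleteSpace H₁] [CompleteSpace H₂] (hT : T.IsClosed)
    (hunb : ¬ T.IsBounded) : T.IsAbsMinAttaining ↔ IsCompactOperator T.graphFst := by
  have := hT.isClosed_hilbertGraph.completeSpace_coe
  rw [isAbsMinAttaining_iff]
  constructor
  · intro h
    by_contra hA
    obtain ⟨M, hM, hM0, hno⟩ :=
      ContinuousLinearMap.exists_isClosed_forall_not_norm_attaining T.graphFst_injective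
        (fun _ hC => hunb (isBounded_of_antilipschitzWith_graphFst hC)) hA
    obtain ⟨k, hk, hk0, hmax⟩ := h M hM hM0
    obtain ⟨y, hy, hlt⟩ := hno k hk hk0
    exact absurd (hmax y hy) hlt.not_ge
  · intro hA M hM hM0
    exact hA.exists_norm_attaining_on (hM.preimage T.graphFst.continuous) hM0

theorem finiteDimensional_nullSpace_of_isCompactOperator_graphFst (hT : T.IsClosed)
    (hA : IsCompactOperator T.graphFst) : FiniteDimensional ℂ T.nullSpace := by
  have hmem : ∀ x : T.nullSpace, WithLp.toLp 2 ((x : H₁), (0 : H₂)) ∈ T.hilbertGraph := by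
    rintro ⟨_, x, hx, rfl⟩
    have h0 : T x = 0 := hx
    exact T.mem_graph_iff'.2 ⟨x, by simp [h0]⟩
  let J : T.nullSpace →L[ℂ] T.hilbertGraph :=
    ((WithLp.prodContinuousLinearEquiv 2 ℂ H₁ H₂).symm.toContinuousLinearMap ∘L
      ContinuousLinearMap.inl ℂ H₁ H₂ ∘L T.nullSpace.subtypeL).codRestrict _ hmem
  exact FiniteDimensional.of_isCompactOperator_id (𝕜 := ℂ)
    ((hA.comp_clm J).codRestrict (V := T.nullSpace) (fun x => x.2) hT.isClosed_nullSpace)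

/-- Compactness yields a minimiser `x` of `‖T x‖ / ‖x‖` on `D(T) ∩ N(T)ᗮ`; the minimum is positive,
since `T x = 0` would put `x` in `N(T) ∩ N(T)ᗮ`. -/
theorem exists_norm_le_graphSnd_of_isCompactOperator_graphFst
    [CompleteSpace H₁] [CompleteSpace H₂] (hT : T.IsClosed) (hA : IsCompactOperator T.graphFst) :
    ∃ C ≥ 0, ∀ g, T.graphFst g ∈ T.nullSpaceᗮ → ‖g‖ ≤ C * ‖T.graphSnd g‖ := by
  have := hT.isClosed_hilbertGraph.completeSpace_coe
  let G₀ : Submodule ℂ T.hilbertGraph :=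
    T.nullSpaceᗮ.comap (T.graphFst : T.hilbertGraph →ₗ[ℂ] H₁)
  rcases eq_or_ne G₀ ⊥ with h0 | h0
  · refine ⟨0, le_rfl, fun g hg => ?_⟩
    have hg0 : g = 0 := (Submodule.eq_bot_iff _).1 h0 g hg
    simp [hg0]
  obtain ⟨k, hk, hk0, hmax⟩ := hA.exists_norm_attaining_on
    (K := G₀) (T.nullSpace.isClosed_orthogonal.preimage T.graphFst.continuous) h0
  obtain ⟨x, rfl⟩ := T.graphMk_surjective k
  have hx0 : (x : H₁) ≠ 0 := fun h => hk0 (T.graphFst_injective (by simpa using h))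
  have hTx : 0 < ‖T x‖ := by
    rw [norm_pos_iff]
    intro h
    exact hx0 (inner_self_eq_zero.1 (hk x ⟨x, h, rfl⟩))
  have hxpos := norm_pos_iff.2 hx0
  set m := ‖T x‖ / ‖(x : H₁)‖ with hm
  have hmpos : 0 < m := div_pos hTx hxpos
  refine ⟨1 + m⁻¹, by positivity, fun h hh => ?_⟩
  have h1 := hmax h hh
  obtain ⟨y, rfl⟩ := T.graphMk_surjective h
  rw [mul_norm_graphMk_le_iff] at h1
  rw [graphSnd_graphMk]
  have h2 : ‖(y : H₁)‖ ≤ m⁻¹ * ‖T y‖ := by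
    rw [hm, inv_div, div_mul_eq_mul_div, le_div_iff₀ hTx]
    linarith
  refine le_of_sq_le_sq ?_ (by positivity)
  rw [norm_graphMk_sq]
  have h3 : 0 ≤ m⁻¹ * ‖T y‖ := by positivity
  nlinarith [norm_nonneg (y : H₁), norm_nonneg (T y)]

theorem exists_mem_orthogonal_nullSpace_map_eq [CompleteSpace H₁] (hT : T.IsClosed)
    (z : T.domain) : ∃ w : T.domain, (w : H₁) ∈ T.nullSpaceᗮ ∧ T w = T z := by
  have := hT.isClosed_nullSpace.completeSpace_coe
  obtain ⟨u, ⟨u', hu', rfl⟩, v, hv, huv⟩ := T.nullSpace.exists_add_mem_mem_orthogonal (z : H₁)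
  have h0 : T u' = 0 := hu'
  have hzu : ((z - u' : T.domain) : H₁) = v := by simp [huv]
  exact ⟨z - u', by rwa [hzu], by rw [map_sub, h0, sub_zero]⟩

theorem isCompactEverywhere_moorePenrose_of_isCompactOperator_graphFst
    [CompleteSpace H₁] [CompleteSpace H₂] (hT : T.IsClosed) (hA : IsCompactOperator T.graphFst) :
    T.moorePenrose.IsCompactEverywhere := by
  have := hT.isClosed_hilbertGraph.completeSpace_coe
  obtain ⟨C, hC, hbound⟩ := exists_norm_le_graphSnd_of_isCompactOperator_graphFst hT hA
  obtain ⟨L, hL⟩ := T.graphSnd.exists_leastSquares_inverse_on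
    (K := T.nullSpaceᗮ.comap (T.graphFst : T.hilbertGraph →ₗ[ℂ] H₁))
    (T.nullSpace.isClosed_orthogonal.preimage T.graphFst.continuous) hC hbound
  let K : H₂ →L[ℂ] H₁ := T.graphFst ∘L L
  have hgraph : ∀ y, (y, K y) ∈ T.moorePenrose.graph := by
    intro y
    obtain ⟨hy, hLy⟩ := hL y
    obtain ⟨z, hz⟩ := T.graphMk_surjective (L y)
    rw [mem_graph_moorePenrose]
    refine ⟨hy, z, congrArg T.graphFst hz, ?_⟩
    rintro _ ⟨x, rfl⟩
    -- The least squares condition tests only `D(T) ∩ N(T)ᗮ`, but `T` already takes all its values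
    -- there.
    obtain ⟨w, hw, hwx⟩ := exists_mem_orthogonal_nullSpace_map_eq hT x
    have := hLy (T.graphMk w) hw
    rwa [← hz, graphSnd_graphMk, graphSnd_graphMk, hwx] at this
  refine ⟨K, hA.comp_clm L, eq_of_eq_graph ?_⟩
  have hfun : ∀ {y x}, (y, x) ∈ T.moorePenrose.graph → x = K y := fun {y x} hx =>
    T.moorePenrose.mem_graph_snd_inj hx (hgraph y) rfl
  ext ⟨y, x⟩
  constructor
  · intro hx
    rw [hfun hx]
    exact (mem_graph_iff _).2 ⟨⟨y, trivial⟩, rfl, rfl⟩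
  · intro hx
    obtain ⟨z, rfl, rfl⟩ := (mem_graph_iff _).1 hx
    exact hgraph z

theorem isCompactOperator_graphFst_of_moorePenrose [FiniteDimensional ℂ T.nullSpace]
    (h : T.moorePenrose.IsCompactEverywhere) : IsCompactOperator T.graphFst := by
  obtain ⟨K, hK, hTK⟩ := h
  -- This is `x = P x + T† T x`: a finite-rank term plus a compact one.
  have hsplit : ⇑T.graphFst = ⇑(T.nullSpace.starProjection ∘L T.graphFst) + K ∘ T.graphSnd := by
    funext k
    obtain ⟨x, rfl⟩ := T.graphMk_surjective k
    obtain ⟨u, hu, hux⟩ := T.nullSpace.starProjection_apply_mem (x : H₁)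
    have hmem : (T x, (x : H₁) - T.nullSpace.starProjection x) ∈ T.moorePenrose.graph := by
      rw [mem_graph_moorePenrose]
      refine ⟨T.nullSpace.sub_starProjection_mem_orthogonal x, x - u, ?_, ?_⟩
      · rw [← hux]; rfl
      · have h0 : T u = 0 := hu
        simp [map_sub, h0]
    rw [hTK] at hmem
    obtain ⟨z, hz, hKz⟩ := (mem_graph_iff _).1 hmem
    have hKx : K (T x) = (x : H₁) - T.nullSpace.starProjection x := by
      exact (congrArg K hz.symm).trans hKz
    simp [hKx]
  rw [hsplit]
  refine IsCompactOperator.add ?_ (hK.comp_clm T.graphSnd)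
  have := FiniteDimensional.proper ℂ T.nullSpace
  exact (isCompactOperator_of_locallyCompactSpace_dom
    (T.nullSpace.orthogonalProjectionOnto ∘L T.graphFst)).clm_comp T.nullSpace.subtypeL

end Closed

end LinearPMap

theorem theorem3 {H₁ H₂ : Type*}
    [NormedAddCommGroup H₁] [InnerProductSpace ℂ H₁] [CompleteSpace H₁]
    [NormedAddCommGroup H₂] [InnerProductSpace ℂ H₂] [CompleteSpace H₂]
    (T : H₁ →ₗ.[ℂ] H₂) (hdense : Dense (T.domain : Set H₁)) (hclosed : T.IsClosed)
    (hunb : ¬ T.IsBounded) :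
    T.IsAbsMinAttaining ↔
      FiniteDimensional ℂ T.nullSpace ∧ T.moorePenrose.IsCompactEverywhere := by
  rw [hclosed.isAbsMinAttaining_iff_isCompactOperator_graphFst hunb]
  constructor
  · intro hA
    exact ⟨LinearPMap.finiteDimensional_nullSpace_of_isCompactOperator_graphFst hclosed hA,
      LinearPMap.isCompactEverywhere_moorePenrose_of_isCompactOperator_graphFst hclosed hA⟩
  · rintro ⟨hN, hK⟩
    exact LinearPMap.isCompactOperator_graphFst_of_moorePenrose hK
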